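/- A full binary tree of size $n$ is a plane rooted tree with $n$ internal nodes, each having a left and a right child, and $n+1$ leaves. A relaxed binary tree of size $n$ is obtained from a full binary tree of size $n$ by keeping its first leaf in post-order (left subtree, right subtree, root) and replacing each of the other $n$ leaves by a pointer to a node (an internal node or the kept leaf) that is visited before that leaf in the post-order traversal. Its right height is the maximal number of right edges on a path from the root to an internal node in the underlying full binary tree (and $0$ if $n=0$). For integers $k,n\ge 0$ let $r_{k,n}$ be the number of relaxed binary trees of size $n$ and right height at most $k$. Then for every $k\ge 0$ there is a constant $\gamma_k>0$, independent of $n$, such that, as $n\to\infty$, $$ r_{k,n} \sim \gamma_k\, n!\,\left(4\cos^2\left(\frac{\pi}{k+3}\right)\right)^{n} n^{-k/2}. $$ -/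

import Mathlib

namespace RelaxedTrees

/-- A plane full binary tree: `nil` is a leaf, `node` an internal node with its two children.
Its size is the number `BinaryTree.numNodes` of its internal nodes. -/
abbrev FullTree : Type := BinaryTree Unit

/-- The address of a node: the sequence of edges of the path from the root to that node,
with `false` for a left edge and `true` for a right edge. -/
abbrev Address : Type := List Bool

/-- The fringe subtree at an address (`none` if there is no node at that address). -/
def subtreeAt : FullTree → Address → Option FullTree
  | t, [] => some t
  | .nil, _ :: _ => none
  | .node _ l _, false :: a => subtreeAt l a
  | .node _ _ r, true :: a => subtreeAt r a

/-- There is a leaf of the full binary tree `t` at the address `a`. -/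
def IsLeaf (t : FullTree) (a : Address) : Prop :=
  subtreeAt t a = some .nil

/-- There is an internal node of `t` at the address `a`. The internal nodes are the nodes
of the spine. -/
def IsInternal (t : FullTree) (a : Address) : Prop :=
  ∃ l r : FullTree, subtreeAt t a = some (.node () l r)

/-- The addresses of all nodes (internal nodes and leaves) in the order of the post-order
traversal: left subtree, right subtree, root. -/
def postorder : FullTree → List Address
  | .nil => [[]]
  | .node _ l r =>
      (postorder l).map (fun a => false :: a) ++ (postorder r).map (fun a => true :: a) ++ [[]]

/-- The node at `a` is visited strictly before the node at `b` by the post-order traversal. -/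
def VisitedBefore (t : FullTree) (a b : Address) : Prop :=
  (postorder t).idxOf a < (postorder t).idxOf b

/-- The first leaf in the post-order traversal. It is the only leaf that is kept. -/
def IsFirstLeaf (t : FullTree) (a : Address) : Prop :=
  IsLeaf t a ∧ ∀ b : Address, IsLeaf t b → ¬ VisitedBefore t b a

/-- The positions of the pointers: all leaves but the first one. -/
def IsPointerPosition (t : FullTree) (a : Address) : Prop :=
  IsLeaf t a ∧ ¬ IsFirstLeaf t a

/-- The nodes that remain when all leaves but the first one are replaced by pointers:
the internal nodes and the unique leaf. -/
def IsNode (t : FullTree) (a : Address) : Prop :=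
  IsInternal t a ∨ IsFirstLeaf t a

/-- A relaxed binary tree of size `n`: a full binary tree with `n` internal nodes in which every
leaf but the first one (in post-order) is replaced by a pointer to a node that has been visited
before by the post-order traversal. -/
structure RelaxedTree (n : ℕ) where
  /-- The underlying full binary tree. -/
  tree : FullTree
  /-- The size is the number of internal nodes. -/
  size_eq : tree.numNodes = n
  /-- The target of each pointer. -/
  pointer : (a : {a : Address // IsPointerPosition tree a}) →
    {b : Address // IsNode tree b ∧ VisitedBefore tree b a}

/-- The right height of the spine: the maximal number of right edges on a path from the root to
an internal node (`0` for the tree of size `0`, whose spine is empty). -/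
noncomputable def rightHeight (t : FullTree) : ℕ :=
  sSup {m : ℕ | ∃ a : Address, IsInternal t a ∧ a.count true = m}

/-- The number of relaxed binary trees of size `n` and right height at most `k`. -/
noncomputable def relaxedCount (k n : ℕ) : ℕ :=
  Nat.card {T : RelaxedTree n // rightHeight T.tree ≤ k}

end RelaxedTrees

/-!
Reading a tree in post-order maintains a stack of trees: every leaf is pushed, and every internal
node merges the two trees on top. A bound `k` on the right height bounds the stack, and the leaf
read after `p + 1` leaves with `h + 1` trees on the stack has `p + 1 - h` possible targets. After
division by `p!`, the vector of the weighted numbers of prefixes of traversals therefore satisfies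
`x (p + 1) = T (1 - D / (p + 1)) x p` with a fixed nonnegative matrix `T` and `D = diag (0, …, k)`.

Conjugating by the Perron eigenvector of `T` makes `T` stochastic with a positive column, so it
contracts the diameter of a vector, by Doeblin's estimate. Hence `x p`, so conjugated, stays within
a relative error `O(1 / p)` of a constant vector, and its mean for the stationary distribution
satisfies the hypotheses of Gauss's ratio test. This yields `x p ∼ c v λ ^ p p ^ (-θ)`, where `u`
and `v` are the left and right Perron eigenvectors and `θ = u T D v / (λ u v) = u D v / (u v)`.

The eigenvectors are explicit in terms of sines of multiples of `π / (k + 3)`, with eigenvalue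
`λ = 4 cos² (π / (k + 3))`. Since `u i * v i` is invariant under `i ↦ k - i`, the exponent `θ`, the
mean of `i` for the weights `u i * v i`, is `k / 2`.
-/

/-! ### Asymptotics of real sequences -/

section Sequences

open Filter Topology Asymptotics

theorem isBigO_log_one_add_sub_self :
    (fun x : ℝ => Real.log (1 + x) - x) =O[𝓝 0] fun x => x ^ 2 := by
  have hre : Tendsto (fun x : ℝ => (x : ℂ)) (𝓝 0) (𝓝 0) :=
    Complex.continuous_ofReal.tendsto' 0 0 rfl
  refine ((Complex.log_sub_self_isBigO.comp_tendsto hre).norm_norm.congr' ?_ ?_).of_norm_norm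
  · have hpos : ∀ᶠ x : ℝ in 𝓝 0, -1 < x := lt_mem_nhds (by norm_num)
    filter_upwards [hpos] with x hx
    rw [Function.comp_apply, ← Complex.norm_real, Complex.ofReal_sub,
      Complex.ofReal_log (by linarith)]
    push_cast
    rfl
  · exact .of_forall fun x => by simp

theorem exists_tendsto_of_isBigO_sub {E : Type*} [NormedAddCommGroup E] [CompleteSpace E]
    {L : ℕ → E} {g : ℕ → ℝ} (hg : Summable g)
    (h : (fun n => L (n + 1) - L n) =O[atTop] g) : ∃ l, Tendsto L atTop (𝓝 l) := by
  refine cauchySeq_tendsto_of_complete (cauchySeq_of_summable_dist ?_)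
  refine summable_of_isBigO_nat hg (h.norm_left.congr_left fun n => ?_)
  rw [dist_comm, dist_eq_norm]

theorem summable_one_div_nat_add_one_sq : Summable fun n : ℕ => (1 / ((n : ℝ) + 1)) ^ 2 := by
  have := (summable_nat_add_iff 1).2 (Real.summable_one_div_nat_pow.2 one_lt_two)
  simpa using this

theorem isBigO_log_one_add_sub_of_isBigO {b : ℕ → ℝ}
    (hb : b =O[atTop] fun n : ℕ => 1 / ((n : ℝ) + 1)) :
    (fun n => Real.log (1 + b n) - b n) =O[atTop] fun n : ℕ => (1 / ((n : ℝ) + 1)) ^ 2 :=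
  (isBigO_log_one_add_sub_self.comp_tendsto
    (hb.trans_tendsto tendsto_one_div_add_atTop_nhds_zero_nat)).trans (hb.pow 2)

theorem exists_tendsto_log_add_mul_log_of_ratio {f : ℕ → ℝ} {θ : ℝ}
    (hf : ∀ᶠ n in atTop, 0 < f n)
    (h : (fun n : ℕ => f (n + 1) / f n - (1 - θ * (1 / ((n : ℝ) + 1)))) =O[atTop]
      fun n : ℕ => (1 / ((n : ℝ) + 1)) ^ 2) :
    ∃ l, Tendsto (fun n : ℕ => Real.log (f n) + θ * Real.log n) atTop (𝓝 l) := by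
  set ε : ℕ → ℝ := fun n => 1 / ((n : ℝ) + 1) with hε
  set a : ℕ → ℝ := fun n => f (n + 1) / f n - 1 with ha
  have haε : a =O[atTop] ε := by
    have hsq : (fun n => ε n ^ 2) =O[atTop] ε := by
      have hε0 : Tendsto ε atTop (𝓝 0) := tendsto_one_div_add_atTop_nhds_zero_nat
      simpa [pow_two] using (hε0.isBigO_one ℝ).mul (isBigO_refl ε atTop)
    refine ((h.trans hsq).add ((isBigO_refl ε atTop).const_mul_left (-θ))).congr_left fun n => ?_
    simp only [ha]
    ring
  have hlog_ratio := isBigO_log_one_add_sub_of_isBigO haε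
  have hlog_nat := isBigO_log_one_add_sub_of_isBigO (isBigO_refl ε atTop).neg_left
  refine exists_tendsto_of_isBigO_sub summable_one_div_nat_add_one_sq ?_
  refine ((hlog_ratio.sub (hlog_nat.const_mul_left θ)).add h).congr' ?_ .rfl
  filter_upwards [hf, (tendsto_add_atTop_nat 1).eventually hf, eventually_gt_atTop 0]
    with n hn hn1 hn0
  have hn0 : (0 : ℝ) < n := by exact_mod_cast hn0
  have hfrac : 1 + -ε n = n / ((n : ℝ) + 1) := by
    simp only [hε]
    field_simp
    ring
  rw [hfrac, Real.log_div hn0.ne' (by positivity), ha, add_sub_cancel,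
    Real.log_div hn1.ne' hn.ne']
  push_cast
  ring

theorem exists_isEquivalent_rpow_of_ratio {f : ℕ → ℝ} {θ : ℝ} (hf : ∀ᶠ n in atTop, 0 < f n)
    (h : (fun n : ℕ => f (n + 1) / f n - (1 - θ * (1 / ((n : ℝ) + 1)))) =O[atTop]
      fun n : ℕ => (1 / ((n : ℝ) + 1)) ^ 2) :
    ∃ c, 0 < c ∧ f ~[atTop] fun n => c * (n : ℝ) ^ (-θ) := by
  obtain ⟨l, hl⟩ := exists_tendsto_log_add_mul_log_of_ratio hf h
  refine ⟨Real.exp l, Real.exp_pos l, ?_⟩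
  have hexp := (Real.continuous_exp.tendsto l).comp hl
  refine (((isEquivalent_const_iff_tendsto (Real.exp_ne_zero l)).2 hexp).mul
    (IsEquivalent.refl (u := fun n : ℕ => (n : ℝ) ^ (-θ)))).congr_left ?_
  filter_upwards [hf, eventually_gt_atTop 0] with n hn hn0
  have hn0 : (0 : ℝ) < n := by exact_mod_cast hn0
  simp only [Pi.mul_apply, Function.comp_apply]
  rw [Real.exp_add, Real.exp_log hn, Real.rpow_def_of_pos hn0, mul_assoc, ← Real.exp_add,
    mul_neg, mul_comm θ, add_neg_cancel, Real.exp_zero, mul_one]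

theorem isBigO_one_div_of_le_mul_add {r : ℕ → ℝ} {ρ K : ℝ} (hr : ∀ n, 0 ≤ r n) (hρ0 : 0 ≤ ρ)
    (hρ : ρ < 1) (h : ∀ᶠ n : ℕ in atTop, r (n + 1) ≤ ρ * r n + K * (1 / ((n : ℝ) + 1))) :
    r =O[atTop] fun n : ℕ => 1 / ((n : ℝ) + 1) := by
  obtain ⟨N, hN⟩ := eventually_atTop.1 (h.and (tendsto_natCast_atTop_atTop.eventually_ge_atTop
    (2 / (1 - ρ))))
  set M : ℝ := max (r N * ((N : ℝ) + 1)) (2 * K / (1 - ρ))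
  have hM0 : 0 ≤ M := le_max_of_le_left (mul_nonneg (hr N) (by positivity))
  have hKM : 2 * K ≤ M * (1 - ρ) := (div_le_iff₀ (by linarith)).1 (le_max_right _ _)
  have bound (n : ℕ) (hn : N ≤ n) : r n ≤ M / ((n : ℝ) + 1) := by
    induction n, hn using Nat.le_induction with
    | base => exact (le_div_iff₀ (by positivity)).2 (le_max_left _ _)
    | succ n hn ih =>
      obtain ⟨hstep, hlarge⟩ := hN n hn
      have hlarge : 2 ≤ n * (1 - ρ) := (div_le_iff₀ (by linarith)).1 hlarge
      calc r (n + 1) ≤ ρ * (M / ((n : ℝ) + 1)) + K * (1 / ((n : ℝ) + 1)) := by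
            linarith [mul_le_mul_of_nonneg_left ih hρ0]
        _ = (ρ * M + K) / ((n : ℝ) + 1) := by ring
        _ ≤ M / (((n + 1 : ℕ) : ℝ) + 1) := by
            rw [div_le_div_iff₀ (by positivity) (by positivity)]
            push_cast
            nlinarith
  refine .of_bound M ?_
  filter_upwards [eventually_ge_atTop N] with n hn
  rw [Real.norm_of_nonneg (hr n), Real.norm_of_nonneg (by positivity), mul_one_div]
  exact bound n hn

end Sequences

/-! ### Perturbations of positive linear recursions -/

section PerturbedOrbits

open Filter Topology Asymptotics Matrix

variable {ι : Type*} [Fintype ι]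

theorem mulVec_le_of_mem_rowStochastic [DecidableEq ι] {P : Matrix ι ι ℝ}
    (hP : P ∈ rowStochastic ℝ ι) {δ b : ℝ} {i k : ι} (hδ : δ ≤ P i k) {y : ι → ℝ}
    (hy : ∀ l, y l ≤ b) : (P *ᵥ y) i ≤ b - δ * (b - y k) := by
  have hgap (l : ι) : 0 ≤ P i l * (b - y l) :=
    mul_nonneg (nonneg_of_mem_rowStochastic hP) (sub_nonneg.2 (hy l))
  have hsum : b - (P *ᵥ y) i = ∑ l, P i l * (b - y l) := by
    simp only [mul_sub, Finset.sum_sub_distrib, ← Finset.sum_mul, sum_row_of_mem_rowStochastic hP,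
      one_mul]
    rfl
  have hk : P i k * (b - y k) ≤ b - (P *ᵥ y) i :=
    hsum ▸ Finset.single_le_sum (fun l _ => hgap l) (Finset.mem_univ k)
  linarith [mul_le_mul_of_nonneg_right hδ (sub_nonneg.2 (hy k))]

theorem dist_le_diam_range {κ : Type*} [Finite κ] (y : κ → ℝ) (i j : κ) :
    dist (y i) (y j) ≤ Metric.diam (Set.range y) :=
  Metric.dist_le_diam_of_mem (Set.finite_range y).isBounded ⟨i, rfl⟩ ⟨j, rfl⟩

theorem diam_range_le {κ : Type*} {y : κ → ℝ} {C : ℝ} (hC : 0 ≤ C) (h : ∀ i j, y i - y j ≤ C) :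
    Metric.diam (Set.range y) ≤ C := by
  refine Metric.diam_le_of_forall_dist_le hC ?_
  rintro _ ⟨i, rfl⟩ _ ⟨j, rfl⟩
  exact abs_sub_le_iff.2 ⟨h i j, h j i⟩

theorem diam_range_mulVec_le [DecidableEq ι] {P : Matrix ι ι ℝ} (hP : P ∈ rowStochastic ℝ ι)
    {δ : ℝ} {k : ι} (hδ : ∀ i, δ ≤ P i k) (y : ι → ℝ) :
    Metric.diam (Set.range (P *ᵥ y)) ≤ (1 - δ) * Metric.diam (Set.range y) := by
  have : Nonempty ι := ⟨k⟩
  obtain ⟨l, hl⟩ := Finite.exists_min y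
  set d := Metric.diam (Set.range y)
  have hd : 0 ≤ d := Metric.diam_nonneg
  have hδ1 : δ ≤ 1 := (hδ k).trans (le_one_of_mem_rowStochastic hP)
  refine diam_range_le (mul_nonneg (by linarith) hd) fun i j => ?_
  have hupper : (P *ᵥ y) i ≤ y l + d - δ * (y l + d - y k) :=
    mulVec_le_of_mem_rowStochastic hP (hδ i) fun m => by
      linarith [le_abs_self (y m - y l), dist_le_diam_range y m l, Real.dist_eq (y m) (y l)]
  have hlower : (P *ᵥ -y) j ≤ -y l - δ * (-y l - (-y) k) :=
    mulVec_le_of_mem_rowStochastic hP (hδ j) fun m => neg_le_neg (hl m)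
  rw [mulVec_neg, Pi.neg_apply, Pi.neg_apply] at hlower
  linarith

theorem diam_range_sub_le (a b : ι → ℝ) :
    Metric.diam (Set.range (a - b)) ≤ Metric.diam (Set.range a) + 2 * ‖b‖ := by
  refine diam_range_le (by positivity) fun i j => ?_
  have hi := abs_le.1 (norm_le_pi_norm b i)
  have hj := abs_le.1 (norm_le_pi_norm b j)
  have ha := (le_abs_self _).trans (dist_le_diam_range a i j)
  simp only [Pi.sub_apply]
  linarith

theorem dotProduct_pos_of_pos {w y : ι → ℝ} (hw : ∀ i, 0 < w i) (hy : 0 < y) : 0 < w ⬝ᵥ y := by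
  obtain ⟨hy0, i, hi⟩ := Pi.lt_def.1 hy
  exact Finset.sum_pos' (fun j _ => mul_nonneg (hw j).le (hy0 j))
    ⟨i, Finset.mem_univ i, mul_pos (hw i) hi⟩

theorem isBigO_dotProduct_of_pos {α : Type*} {l : Filter α} {y : α → ι → ℝ} {w : ι → ℝ}
    (hw : ∀ i, 0 < w i) (hy : ∀ a, 0 ≤ y a) : y =O[l] fun a => w ⬝ᵥ y a := by
  refine isBigO_pi.2 fun i => .of_bound (w i)⁻¹ (.of_forall fun a => ?_)
  have hsum : w i * y a i ≤ w ⬝ᵥ y a :=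
    Finset.single_le_sum (f := fun j => w j * y a j)
      (fun j _ => mul_nonneg (hw j).le (hy a j)) (Finset.mem_univ i)
  have hdot : 0 ≤ w ⬝ᵥ y a := hsum.trans' (mul_nonneg (hw i).le (hy a i))
  rw [Real.norm_of_nonneg (hy a i), Real.norm_of_nonneg hdot, inv_mul_eq_div,
    le_div_iff₀' (hw i)]
  exact hsum

theorem mulVec_isBigO {α : Type*} {l : Filter α} {κ : Type*} [Fintype κ] (Q : Matrix κ ι ℝ)
    (y : α → ι → ℝ) : (fun a => Q *ᵥ y a) =O[l] y :=
  (LinearMap.toContinuousLinearMap Q.mulVecLin).isBigO_comp y l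

theorem dotProduct_isBigO {α : Type*} {l : Filter α} (w : ι → ℝ) (y : α → ι → ℝ) :
    (fun a => w ⬝ᵥ y a) =O[l] y :=
  (LinearMap.toContinuousLinearMap (dotProductBilin ℝ ℝ w)).isBigO_comp y l

theorem norm_sub_dotProduct_smul_one_le {w : ι → ℝ} (hw : ∀ i, 0 ≤ w i) (hw1 : ∑ i, w i = 1)
    (y : ι → ℝ) : ‖y - (w ⬝ᵥ y) • 1‖ ≤ Metric.diam (Set.range y) := by
  refine (pi_norm_le_iff_of_nonneg Metric.diam_nonneg).2 fun i => ?_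
  have hsum : (y - (w ⬝ᵥ y) • 1) i = ∑ j, w j * (y i - y j) := by
    simp only [mul_sub, Finset.sum_sub_distrib, ← Finset.sum_mul, hw1, one_mul, Pi.sub_apply,
      Pi.smul_apply, Pi.one_apply, smul_eq_mul, mul_one]
    rfl
  calc ‖(y - (w ⬝ᵥ y) • 1) i‖ ≤ ∑ j, ‖w j * (y i - y j)‖ := hsum ▸ norm_sum_le _ _
    _ ≤ ∑ j, w j * Metric.diam (Set.range y) := by
        refine Finset.sum_le_sum fun j _ => ?_
        rw [norm_mul, Real.norm_of_nonneg (hw j)]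
        exact mul_le_mul_of_nonneg_left (dist_le_diam_range y i j) (hw j)
    _ = Metric.diam (Set.range y) := by rw [← Finset.sum_mul, hw1, one_mul]

/-- A nonnegative nonzero solution of the linear recursion with coefficient matrix
`A - B / (p + 1)`, a perturbation of order `1 / p` of the matrix `A`. -/
structure IsPerturbedOrbit (A B : Matrix ι ι ℝ) (x : ℕ → ι → ℝ) : Prop where
  pos : ∀ p, 0 < x p
  succ : ∀ p, x (p + 1) = A *ᵥ x p - (1 / ((p : ℝ) + 1)) • B *ᵥ x p

namespace IsPerturbedOrbit

section Stochastic

variable {P Q : Matrix ι ι ℝ} {w : ι → ℝ} {y : ℕ → ι → ℝ}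

theorem dotProduct_succ (hy : IsPerturbedOrbit P Q y) (hwP : w ᵥ* P = w) (p : ℕ) :
    w ⬝ᵥ y (p + 1) = w ⬝ᵥ y p - (w ⬝ᵥ Q *ᵥ y p) * (1 / ((p : ℝ) + 1)) := by
  rw [hy.succ, dotProduct_sub, dotProduct_mulVec, hwP, dotProduct_smul, smul_eq_mul, mul_comm]

theorem mulVec_isBigO_dotProduct (hy : IsPerturbedOrbit P Q y) (hw : ∀ i, 0 < w i) :
    (fun p => Q *ᵥ y p) =O[atTop] fun p => w ⬝ᵥ y p :=
  (mulVec_isBigO Q y).trans (isBigO_dotProduct_of_pos hw fun p => (hy.pos p).le)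

theorem tendsto_dotProduct_div_succ (hy : IsPerturbedOrbit P Q y) (hw : ∀ i, 0 < w i)
    (hwP : w ᵥ* P = w) :
    Tendsto (fun p => (w ⬝ᵥ y p) / (w ⬝ᵥ y (p + 1))) atTop (𝓝 1) := by
  have hpos (p : ℕ) : 0 < w ⬝ᵥ y p := dotProduct_pos_of_pos hw (hy.pos p)
  have hQ : (fun p => w ⬝ᵥ Q *ᵥ y p) =O[atTop] fun p => w ⬝ᵥ y p :=
    (dotProduct_isBigO w _).trans (hy.mulVec_isBigO_dotProduct hw)
  have hequiv : (fun p => w ⬝ᵥ y (p + 1)) ~[atTop] fun p => w ⬝ᵥ y p := by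
    have := hQ.mul_isLittleO
      ((isLittleO_one_iff ℝ).2 (tendsto_one_div_add_atTop_nhds_zero_nat (𝕜 := ℝ)))
    refine (this.neg_left.congr (fun p => ?_) fun p => mul_one _ : _ =o[atTop] _)
    rw [Pi.sub_apply, hy.dotProduct_succ hwP]
    ring
  exact (isEquivalent_iff_tendsto_one (.of_forall fun p => (hpos (p + 1)).ne')).1 hequiv.symm

theorem diam_range_succ_le [DecidableEq ι] (hy : IsPerturbedOrbit P Q y)
    (hP : P ∈ rowStochastic ℝ ι) {δ : ℝ} {k : ι} (hδ : ∀ i, δ ≤ P i k) (p : ℕ) :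
    Metric.diam (Set.range (y (p + 1))) ≤
      (1 - δ) * Metric.diam (Set.range (y p)) + 2 * (1 / ((p : ℝ) + 1) * ‖Q *ᵥ y p‖) := by
  calc Metric.diam (Set.range (y (p + 1)))
      ≤ Metric.diam (Set.range (P *ᵥ y p)) + 2 * ‖(1 / ((p : ℝ) + 1)) • Q *ᵥ y p‖ :=
        hy.succ p ▸ diam_range_sub_le _ _
    _ ≤ _ := by
        rw [norm_smul, Real.norm_of_nonneg (by positivity)]
        gcongr
        exact diam_range_mulVec_le hP hδ _

theorem isBigO_diam_range [DecidableEq ι] (hy : IsPerturbedOrbit P Q y)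
    (hP : P ∈ rowStochastic ℝ ι) {k : ι} (hk : ∀ i, 0 < P i k) (hw : ∀ i, 0 < w i)
    (hwP : w ᵥ* P = w) :
    (fun p => Metric.diam (Set.range (y p)) / (w ⬝ᵥ y p)) =O[atTop]
      fun p : ℕ => 1 / ((p : ℝ) + 1) := by
  have : Nonempty ι := ⟨k⟩
  obtain ⟨i₀, hδ⟩ := Finite.exists_min fun i => P i k
  set δ := P i₀ k
  have hδ0 : 0 < δ := hk i₀
  have hδ1 : δ ≤ 1 := le_one_of_mem_rowStochastic hP
  have hpos (p : ℕ) : 0 < w ⬝ᵥ y p := dotProduct_pos_of_pos hw (hy.pos p)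
  obtain ⟨C, hC0, hC⟩ := (hy.mulVec_isBigO_dotProduct hw).exists_pos
  have hratio := (hy.tendsto_dotProduct_div_succ hw hwP).eventually_lt_const
    (show 1 < 1 + δ by linarith)
  refine isBigO_one_div_of_le_mul_add (ρ := (1 - δ) * (1 + δ)) (K := 2 * C * (1 + δ))
    (fun p => div_nonneg Metric.diam_nonneg (hpos p).le) (mul_nonneg (by linarith) (by linarith))
    (by nlinarith) ?_
  filter_upwards [hC.bound, hratio] with p hCp hp
  rw [Real.norm_of_nonneg (hpos p).le] at hCp
  set d := Metric.diam (Set.range (y p))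
  set m := w ⬝ᵥ y p
  set ε : ℝ := 1 / ((p : ℝ) + 1)
  have hε : 0 ≤ ε := by positivity
  have hm : 0 < m := hpos p
  have hdm : 0 ≤ d / m := div_nonneg Metric.diam_nonneg hm.le
  have hcoef : 0 ≤ (1 - δ) * (d / m) + 2 * C * ε :=
    add_nonneg (mul_nonneg (by linarith) hdm) (mul_nonneg (by positivity) hε)
  calc Metric.diam (Set.range (y (p + 1))) / (w ⬝ᵥ y (p + 1))
      ≤ ((1 - δ) * d + 2 * (ε * (C * m))) / (w ⬝ᵥ y (p + 1)) := by
        refine div_le_div_of_nonneg_right ((hy.diam_range_succ_le hP hδ p).trans ?_) (hpos _).le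
        gcongr
    _ = ((1 - δ) * (d / m) + 2 * C * ε) * (m / (w ⬝ᵥ y (p + 1))) := by field_simp
    _ ≤ ((1 - δ) * (d / m) + 2 * C * ε) * (1 + δ) := mul_le_mul_of_nonneg_left hp.le hcoef
    _ = _ := by ring

theorem isBigO_sub_dotProduct_smul_one [DecidableEq ι] (hy : IsPerturbedOrbit P Q y)
    (hP : P ∈ rowStochastic ℝ ι) {k : ι} (hk : ∀ i, 0 < P i k) (hw : ∀ i, 0 < w i)
    (hw1 : ∑ i, w i = 1) (hwP : w ᵥ* P = w) :
    (fun p => y p - (w ⬝ᵥ y p) • 1) =O[atTop] fun p : ℕ => (w ⬝ᵥ y p) * (1 / ((p : ℝ) + 1)) := by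
  have hdiam : (fun p => Metric.diam (Set.range (y p))) =O[atTop]
      fun p : ℕ => (w ⬝ᵥ y p) * (1 / ((p : ℝ) + 1)) :=
    ((isBigO_refl (fun p => w ⬝ᵥ y p) atTop).mul (hy.isBigO_diam_range hP hk hw hwP)).congr_left
      fun p => mul_div_cancel₀ _ (dotProduct_pos_of_pos hw (hy.pos p)).ne'
  refine .trans (.of_norm_le fun p => ?_) hdiam
  exact norm_sub_dotProduct_smul_one_le (fun i => (hw i).le) hw1 (y p)

theorem isBigO_dotProduct_succ_div_sub [DecidableEq ι] (hy : IsPerturbedOrbit P Q y)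
    (hP : P ∈ rowStochastic ℝ ι) {k : ι} (hk : ∀ i, 0 < P i k) (hw : ∀ i, 0 < w i)
    (hw1 : ∑ i, w i = 1) (hwP : w ᵥ* P = w) :
    (fun p : ℕ => (w ⬝ᵥ y (p + 1)) / (w ⬝ᵥ y p) - (1 - (w ⬝ᵥ Q *ᵥ 1) * (1 / ((p : ℝ) + 1))))
      =O[atTop] fun p : ℕ => (1 / ((p : ℝ) + 1)) ^ 2 := by
  have hpos (p : ℕ) : 0 < w ⬝ᵥ y p := dotProduct_pos_of_pos hw (hy.pos p)
  have hdev : (fun p => w ⬝ᵥ Q *ᵥ (y p - (w ⬝ᵥ y p) • 1)) =O[atTop]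
      fun p : ℕ => (w ⬝ᵥ y p) * (1 / ((p : ℝ) + 1)) :=
    (dotProduct_isBigO w _).trans ((mulVec_isBigO Q _).trans
      (hy.isBigO_sub_dotProduct_smul_one hP hk hw hw1 hwP))
  refine (hdev.mul (isBigO_refl (fun p : ℕ => -(1 / (w ⬝ᵥ y p)) * (1 / ((p : ℝ) + 1)))
    atTop)).neg_right.congr (fun p => ?_) fun p => ?_
  · rw [hy.dotProduct_succ hwP, mulVec_sub, mulVec_smul, dotProduct_sub, dotProduct_smul,
      smul_eq_mul]
    have := (hpos p).ne'
    field_simp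
    ring
  · have := (hpos p).ne'
    field_simp

theorem exists_isEquivalent_rpow [DecidableEq ι] (hy : IsPerturbedOrbit P Q y)
    (hP : P ∈ rowStochastic ℝ ι) {k : ι} (hk : ∀ i, 0 < P i k) (hw : ∀ i, 0 < w i)
    (hw1 : ∑ i, w i = 1) (hwP : w ᵥ* P = w) :
    ∃ c, 0 < c ∧ ∀ i, (fun p => y p i) ~[atTop] fun p => c * (p : ℝ) ^ (-(w ⬝ᵥ Q *ᵥ 1)) := by
  obtain ⟨c, hc, hmean⟩ := exists_isEquivalent_rpow_of_ratio
    (.of_forall fun p => dotProduct_pos_of_pos hw (hy.pos p))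
    (hy.isBigO_dotProduct_succ_div_sub hP hk hw hw1 hwP)
  refine ⟨c, hc, fun i => IsEquivalent.trans ?_ hmean⟩
  have hdev := isBigO_pi.1 (hy.isBigO_sub_dotProduct_smul_one hP hk hw hw1 hwP) i
  have hsmall := (isBigO_refl (fun p => w ⬝ᵥ y p) atTop).mul_isLittleO
    ((isLittleO_one_iff ℝ).2 (tendsto_one_div_add_atTop_nhds_zero_nat (𝕜 := ℝ)))
  exact (hdev.trans_isLittleO hsmall).congr (fun p => by simp) fun p => mul_one _

end Stochastic

end IsPerturbedOrbit

/-- Doob's transform of a matrix by an eigenvector `v` for the eigenvalue `lam`: conjugation by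
`diagonal v` and division by `lam`, which makes the matrix stochastic. -/
def doobTransform {K : Type*} [Field K] (lam : K) (v : ι → K) (A : Matrix ι ι K) : Matrix ι ι K :=
  .of fun i j => A i j * v j / (lam * v i)

theorem doobTransform_mulVec {K : Type*} [Field K] (lam : K) (v : ι → K) (A : Matrix ι ι K)
    (y : ι → K) (i : ι) :
    (doobTransform lam v A *ᵥ y) i = (A *ᵥ (v * y)) i / (lam * v i) := by
  simp only [mulVec, dotProduct, doobTransform, of_apply, Finset.sum_div, Pi.mul_apply]
  exact Finset.sum_congr rfl fun j _ => by ring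

theorem doobTransform_mem_rowStochastic [DecidableEq ι] {A : Matrix ι ι ℝ} {lam : ℝ} {v : ι → ℝ}
    (hA : ∀ i j, 0 ≤ A i j) (hlam : 0 < lam) (hv : ∀ i, 0 < v i) (hAv : A *ᵥ v = lam • v) :
    doobTransform lam v A ∈ rowStochastic ℝ ι := by
  refine ⟨fun i j => div_nonneg (mul_nonneg (hA i j) (hv j).le) (mul_pos hlam (hv i)).le, ?_⟩
  ext i
  rw [doobTransform_mulVec, mul_one, hAv, Pi.smul_apply, smul_eq_mul, Pi.one_apply,
    div_self (mul_pos hlam (hv i)).ne']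

theorem vecMul_doobTransform {K : Type*} [Field K] {A : Matrix ι ι K} {lam : K} {u v : ι → K}
    (hlam : lam ≠ 0) (hv : ∀ i, v i ≠ 0) (huA : u ᵥ* A = lam • u) :
    (u * v) ᵥ* doobTransform lam v A = u * v := by
  ext j
  have hterm (i : ι) : (u * v) i * doobTransform lam v A i j = u i * A i j * (v j / lam) := by
    have := hv i
    simp only [doobTransform, of_apply, Pi.mul_apply]
    field_simp
  calc ((u * v) ᵥ* doobTransform lam v A) j = (u ᵥ* A) j * (v j / lam) := by
        simp only [vecMul, dotProduct, hterm, Finset.sum_mul]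
    _ = (u * v) j := by
        rw [huA, Pi.smul_apply, smul_eq_mul, Pi.mul_apply]
        field_simp

theorem dotProduct_doobTransform_mulVec_one {K : Type*} [Field K] {B : Matrix ι ι K} {lam : K}
    {u v : ι → K} (hv : ∀ i, v i ≠ 0) :
    (u * v) ⬝ᵥ doobTransform lam v B *ᵥ 1 = (u ⬝ᵥ B *ᵥ v) / lam := by
  simp only [dotProduct, doobTransform_mulVec, mul_one, Pi.mul_apply, Finset.sum_div]
  refine Finset.sum_congr rfl fun i _ => ?_
  have := hv i
  field_simp

namespace IsPerturbedOrbit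

variable {A B : Matrix ι ι ℝ} {u v : ι → ℝ} {x : ℕ → ι → ℝ} {lam : ℝ}

theorem inv_pow_smul_inv_mul (hx : IsPerturbedOrbit A B x) (hlam : 0 < lam) (hv : ∀ i, 0 < v i) :
    IsPerturbedOrbit (doobTransform lam v A) (doobTransform lam v B)
      fun p => (lam ^ p)⁻¹ • (v⁻¹ * x p) where
  pos p := by
    obtain ⟨hx0, i, hi⟩ := Pi.lt_def.1 (hx.pos p)
    refine Pi.lt_def.2 ⟨fun j => ?_, i, ?_⟩
    · exact mul_nonneg (by positivity) (mul_nonneg (inv_nonneg.2 (hv j).le) (hx0 j))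
    · exact mul_pos (by positivity) (mul_pos (inv_pos.2 (hv i)) hi)
  succ p := by
    have hvx : v * (v⁻¹ * x p) = x p := by
      ext j
      exact mul_inv_cancel_left₀ (hv j).ne' _
    ext i
    have := (hv i).ne'
    simp only [Pi.sub_apply, Pi.smul_apply, doobTransform_mulVec, mulVec_smul, hvx, hx.succ,
      Pi.mul_apply, Pi.inv_apply, smul_eq_mul]
    field_simp
    ring

theorem exists_isEquivalent (hx : IsPerturbedOrbit A B x) (hA : ∀ i j, 0 ≤ A i j)
    {k : ι} (hk : ∀ i, 0 < A i k) (hlam : 0 < lam) (hu : ∀ i, 0 < u i) (hv : ∀ i, 0 < v i)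
    (huA : u ᵥ* A = lam • u) (hAv : A *ᵥ v = lam • v) :
    ∃ c, 0 < c ∧ ∀ i, (fun p => x p i) ~[atTop] fun p : ℕ =>
      c * v i * lam ^ p * (p : ℝ) ^ (-((u ⬝ᵥ B *ᵥ v) / (lam * (u ⬝ᵥ v)))) := by
  classical
  have : Nonempty ι := ⟨k⟩
  have hv0 (i : ι) : v i ≠ 0 := (hv i).ne'
  have huv : 0 < u ⬝ᵥ v := Finset.sum_pos (fun i _ => mul_pos (hu i) (hv i)) Finset.univ_nonempty
  set w : ι → ℝ := (u ⬝ᵥ v)⁻¹ • (u * v)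
  have hw (i : ι) : 0 < w i := mul_pos (inv_pos.2 huv) (mul_pos (hu i) (hv i))
  have hw1 : ∑ i, w i = 1 := by
    simp only [w, Pi.smul_apply, ← Finset.smul_sum]
    exact inv_mul_cancel₀ huv.ne'
  have hwA : w ᵥ* doobTransform lam v A = w := by
    rw [smul_vecMul, vecMul_doobTransform hlam.ne' hv0 huA]
  have hθ : w ⬝ᵥ doobTransform lam v B *ᵥ 1 = (u ⬝ᵥ B *ᵥ v) / (lam * (u ⬝ᵥ v)) := by
    rw [smul_dotProduct, dotProduct_doobTransform_mulVec_one hv0, smul_eq_mul, inv_mul_eq_div,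
      div_div]
  obtain ⟨c, hc, h⟩ := (hx.inv_pow_smul_inv_mul hlam hv).exists_isEquivalent_rpow (k := k)
    (doobTransform_mem_rowStochastic hA hlam hv hAv)
    (fun i => div_pos (mul_pos (hk i) (hv k)) (mul_pos hlam (hv i))) hw hw1 hwA
  refine ⟨c, hc, fun i => ?_⟩
  refine ((IsEquivalent.refl (u := fun p : ℕ => v i * lam ^ p)).mul (h i)).congr_left
    (.of_forall fun p => ?_) |>.congr_right (.of_forall fun p => ?_)
  · have := hv0 i
    simp only [Pi.mul_apply, Pi.smul_apply, Pi.inv_apply, smul_eq_mul]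
    field_simp
  · simp only [Pi.mul_apply, hθ]
    ring

end IsPerturbedOrbit

end PerturbedOrbits

/-! ### Post-order traversals -/

namespace RelaxedTrees

open BinaryTree Finset

variable {l r t : FullTree} {a b : Address} {x : Unit}

theorem mem_postorder : a ∈ postorder t ↔ (subtreeAt t a).isSome := by
  induction t generalizing a with
  | nil => cases a <;> simp [postorder, subtreeAt]
  | node x l r hl hr => rcases a with _ | ⟨_ | _, a⟩ <;> simp [postorder, subtreeAt, hl, hr]

theorem IsInternal.mem_postorder (h : IsInternal t a) : a ∈ postorder t := by
  obtain ⟨l, r, h⟩ := h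
  simp [RelaxedTrees.mem_postorder, h]

theorem IsLeaf.mem_postorder (h : IsLeaf t a) : a ∈ postorder t := by
  rw [IsLeaf] at h
  simp [RelaxedTrees.mem_postorder, h]

theorem IsLeaf.not_isInternal (h : IsLeaf t a) : ¬ IsInternal t a := by
  rintro ⟨l, r, h'⟩
  rw [IsLeaf] at h
  simp [h] at h'

@[simp] theorem not_isInternal_nil (a : Address) : ¬ IsInternal .nil a := by
  cases a <;> simp [IsInternal, subtreeAt]

@[simp] theorem isInternal_node_nil : IsInternal (.node x l r) [] := ⟨l, r, rfl⟩

@[simp] theorem isInternal_node_false :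
    IsInternal (.node x l r) (false :: a) ↔ IsInternal l a := Iff.rfl

@[simp] theorem isInternal_node_true :
    IsInternal (.node x l r) (true :: a) ↔ IsInternal r a := Iff.rfl

@[simp] theorem not_isLeaf_node_nil : ¬ IsLeaf (.node x l r) [] := by simp [IsLeaf, subtreeAt]

@[simp] theorem isLeaf_node_false : IsLeaf (.node x l r) (false :: a) ↔ IsLeaf l a := Iff.rfl

@[simp] theorem isLeaf_node_true : IsLeaf (.node x l r) (true :: a) ↔ IsLeaf r a := Iff.rfl

theorem idxOf_map_cons (x : Bool) (l : List Address) (a : Address) :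
    (l.map (fun a => x :: a)).idxOf (x :: a) = l.idxOf a := by
  induction l with
  | nil => rfl
  | cons b l ih => simp [List.idxOf_cons, ih]

theorem idxOf_postorder_left (ha : a ∈ postorder l) :
    (postorder (.node x l r)).idxOf (false :: a) = (postorder l).idxOf a := by
  have h : false :: a ∈ (postorder l).map (fun a => false :: a) := List.mem_map_of_mem ha
  rw [postorder, List.append_assoc, List.idxOf_append_of_mem h]
  exact idxOf_map_cons _ _ a

theorem idxOf_postorder_right (ha : a ∈ postorder r) :
    (postorder (.node x l r)).idxOf (true :: a) =
      (postorder l).length + (postorder r).idxOf a := by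
  have h : true :: a ∈ (postorder r).map (fun a => true :: a) := List.mem_map_of_mem ha
  have h' : true :: a ∉ (postorder l).map (fun a => false :: a) := by simp
  rw [postorder, List.append_assoc, List.idxOf_append_of_notMem h', List.idxOf_append_of_mem h,
    List.length_map]
  congr 1
  exact idxOf_map_cons _ _ a

theorem idxOf_postorder_root :
    (postorder (.node x l r)).idxOf [] = (postorder l).length + (postorder r).length := by
  rw [postorder, List.idxOf_append_of_notMem (by simp)]
  simp

theorem visitedBefore_false_false (hb : b ∈ postorder l) (ha : a ∈ postorder l) :
    VisitedBefore (.node x l r) (false :: b) (false :: a) ↔ VisitedBefore l b a := by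
  rw [VisitedBefore, VisitedBefore, idxOf_postorder_left hb, idxOf_postorder_left ha]

theorem visitedBefore_true_true (hb : b ∈ postorder r) (ha : a ∈ postorder r) :
    VisitedBefore (.node x l r) (true :: b) (true :: a) ↔ VisitedBefore r b a := by
  rw [VisitedBefore, VisitedBefore, idxOf_postorder_right hb, idxOf_postorder_right ha,
    Nat.add_lt_add_iff_left]

theorem visitedBefore_false_true (hb : b ∈ postorder l) (ha : a ∈ postorder r) :
    VisitedBefore (.node x l r) (false :: b) (true :: a) := by
  rw [VisitedBefore, idxOf_postorder_left hb, idxOf_postorder_right ha]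
  exact Nat.lt_add_right _ (List.idxOf_lt_length_of_mem hb)

theorem not_visitedBefore_true_false (hb : b ∈ postorder r) (ha : a ∈ postorder l) :
    ¬ VisitedBefore (.node x l r) (true :: b) (false :: a) := by
  rw [VisitedBefore, idxOf_postorder_right hb, idxOf_postorder_left ha, not_lt]
  exact (List.idxOf_lt_length_of_mem ha).le.trans (Nat.le_add_right _ _)

theorem not_visitedBefore_root (ha : a ∈ postorder (.node x l r)) :
    ¬ VisitedBefore (.node x l r) [] a := by
  have h := List.idxOf_lt_length_of_mem ha
  rw [postorder] at h
  rw [VisitedBefore, idxOf_postorder_root, not_lt]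
  simp only [List.length_append, List.length_map, List.length_singleton] at h
  exact Nat.le_of_lt_succ h

/-- The address of the first leaf in post-order. -/
def firstLeaf : FullTree → Address
  | .nil => []
  | .node _ l _ => false :: firstLeaf l

theorem isLeaf_firstLeaf (t : FullTree) : IsLeaf t (firstLeaf t) := by
  induction t with
  | nil => rfl
  | node _ _ _ hl _ => exact hl

theorem idxOf_postorder_firstLeaf (t : FullTree) : (postorder t).idxOf (firstLeaf t) = 0 := by
  induction t with
  | nil => simp [postorder, firstLeaf]
  | node _ l _ hl _ =>
    rw [firstLeaf, idxOf_postorder_left (isLeaf_firstLeaf l).mem_postorder, hl]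

theorem not_visitedBefore_firstLeaf (t : FullTree) (b : Address) :
    ¬ VisitedBefore t b (firstLeaf t) := by
  simp [VisitedBefore, idxOf_postorder_firstLeaf]

theorem visitedBefore_firstLeaf_iff (ha : a ∈ postorder t) :
    VisitedBefore t (firstLeaf t) a ↔ a ≠ firstLeaf t := by
  rw [VisitedBefore, idxOf_postorder_firstLeaf, Nat.pos_iff_ne_zero,
    ← idxOf_postorder_firstLeaf t, Ne, List.idxOf_inj ha]

theorem isFirstLeaf_iff : IsFirstLeaf t a ↔ a = firstLeaf t := by
  constructor
  · rintro ⟨h, h'⟩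
    by_contra hne
    exact h' _ (isLeaf_firstLeaf t) ((visitedBefore_firstLeaf_iff h.mem_postorder).2 hne)
  · rintro rfl
    exact ⟨isLeaf_firstLeaf t, fun b _ => not_visitedBefore_firstLeaf t b⟩

/-! ### Counting pointer assignments -/

theorem ncard_image_cons_union {s₁ s₂ : Set Address} (h₁ : s₁.Finite) (h₂ : s₂.Finite) :
    (List.cons false '' s₁ ∪ List.cons true '' s₂).ncard = s₁.ncard + s₂.ncard := by
  rw [Set.ncard_union_eq (by simp [Set.disjoint_left]) (h₁.image _) (h₂.image _),
    Set.ncard_image_of_injective _ List.cons_injective,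
    Set.ncard_image_of_injective _ List.cons_injective]

theorem setOf_isInternal_node :
    {b | IsInternal (.node x l r) b} =
      insert [] (List.cons false '' {b | IsInternal l b} ∪
        List.cons true '' {b | IsInternal r b}) := by
  ext b
  rcases b with _ | ⟨_ | _, b⟩ <;> simp

theorem finite_setOf_isInternal (t : FullTree) : {b | IsInternal t b}.Finite := by
  induction t with
  | nil => simp
  | node x l r hl hr =>
    rw [setOf_isInternal_node]
    exact ((hl.image _).union (hr.image _)).insert _

theorem ncard_setOf_isInternal (t : FullTree) : {b | IsInternal t b}.ncard = t.numNodes := by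
  induction t with
  | nil => simp
  | node x l r hl hr =>
    have hfl := finite_setOf_isInternal l
    have hfr := finite_setOf_isInternal r
    rw [setOf_isInternal_node, Set.ncard_insert_of_notMem (by simp)
      ((hfl.image _).union (hfr.image _)), ncard_image_cons_union hfl hfr, hl, hr, numNodes]

/-- The internal nodes visited before the node at `a`. -/
def internalBefore (t : FullTree) (a : Address) : Set Address :=
  {b | IsInternal t b ∧ VisitedBefore t b a}

theorem finite_internalBefore (t : FullTree) (a : Address) : (internalBefore t a).Finite :=
  (finite_setOf_isInternal t).subset fun _ h => h.1

theorem internalBefore_node_false (ha : IsLeaf l a) :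
    internalBefore (.node x l r) (false :: a) = List.cons false '' internalBefore l a := by
  have hroot : ¬ VisitedBefore (.node x l r) [] (false :: a) :=
    not_visitedBefore_root (IsLeaf.mem_postorder ha)
  ext b
  rcases b with _ | ⟨_ | _, b⟩
  · simp [internalBefore, hroot]
  · have hb (h : IsInternal l b) := visitedBefore_false_false (x := x) (r := r)
      h.mem_postorder ha.mem_postorder
    simpa [internalBefore] using hb
  · have hb (h : IsInternal r b) := not_visitedBefore_true_false (x := x)
      h.mem_postorder ha.mem_postorder
    simpa [internalBefore] using hb

theorem internalBefore_node_true (ha : IsLeaf r a) :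
    internalBefore (.node x l r) (true :: a) =
      List.cons false '' {b | IsInternal l b} ∪ List.cons true '' internalBefore r a := by
  have hroot : ¬ VisitedBefore (.node x l r) [] (true :: a) :=
    not_visitedBefore_root (IsLeaf.mem_postorder ha)
  ext b
  rcases b with _ | ⟨_ | _, b⟩
  · simp [internalBefore, hroot]
  · have hb (h : IsInternal l b) := visitedBefore_false_true (x := x)
      h.mem_postorder ha.mem_postorder
    simpa [internalBefore] using hb
  · have hb (h : IsInternal r b) := visitedBefore_true_true (x := x) (l := l)
      h.mem_postorder ha.mem_postorder
    simpa [internalBefore] using hb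

theorem internalBefore_firstLeaf (t : FullTree) : internalBefore t (firstLeaf t) = ∅ :=
  Set.eq_empty_of_forall_notMem fun b h => not_visitedBefore_firstLeaf t b h.2

theorem ncard_internalBefore_node_false (ha : IsLeaf l a) :
    (internalBefore (.node x l r) (false :: a)).ncard = (internalBefore l a).ncard := by
  rw [internalBefore_node_false ha, Set.ncard_image_of_injective _ List.cons_injective]

theorem ncard_internalBefore_node_true (ha : IsLeaf r a) :
    (internalBefore (.node x l r) (true :: a)).ncard =
      l.numNodes + (internalBefore r a).ncard := by
  rw [internalBefore_node_true ha, ncard_image_cons_union (finite_setOf_isInternal l)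
    (finite_internalBefore r a), ncard_setOf_isInternal]

theorem ncard_targets (ha : IsPointerPosition t a) :
    {b | IsNode t b ∧ VisitedBefore t b a}.ncard = 1 + (internalBefore t a).ncard := by
  have hfirst : VisitedBefore t (firstLeaf t) a :=
    (visitedBefore_firstLeaf_iff ha.1.mem_postorder).2 fun h => ha.2 (isFirstLeaf_iff.2 h)
  have hset : {b | IsNode t b ∧ VisitedBefore t b a} =
      insert (firstLeaf t) (internalBefore t a) := by
    ext b
    simp only [IsNode, isFirstLeaf_iff, internalBefore, Set.mem_ofPred_eq, Set.mem_insert_iff,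
      or_and_right]
    rw [or_comm, and_iff_left_of_imp fun h : b = firstLeaf t => h ▸ hfirst]
  have hnotMem : firstLeaf t ∉ internalBefore t a :=
    fun h => (isLeaf_firstLeaf t).not_isInternal h.1
  rw [hset, Set.ncard_insert_of_notMem hnotMem (finite_internalBefore t a), add_comm]

/-- The leaves of a tree, given by their addresses. -/
def leaves : FullTree → Finset Address
  | .nil => {[]}
  | .node _ l r => (leaves l).map ⟨List.cons false, List.cons_injective⟩ ∪
      (leaves r).map ⟨List.cons true, List.cons_injective⟩

@[simp] theorem mem_leaves : a ∈ leaves t ↔ IsLeaf t a := by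
  induction t generalizing a with
  | nil => cases a <;> simp [leaves, IsLeaf, subtreeAt]
  | node x l r hl hr => rcases a with _ | ⟨_ | _, a⟩ <;> simp [leaves, hl, hr]

theorem prod_leaves_node {M : Type*} [CommMonoid M] (f : Address → M) :
    ∏ a ∈ leaves (.node x l r), f a =
      (∏ a ∈ leaves l, f (false :: a)) * ∏ a ∈ leaves r, f (true :: a) := by
  rw [leaves, prod_union (by simp [disjoint_left]), prod_map, prod_map]
  rfl

/-- The product over all leaves of `m` plus the number of internal nodes visited before that leaf:
the number of ways to choose a target for every leaf when `m` targets are available before the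
traversal of the tree starts. -/
def leafWeight : FullTree → ℕ → ℕ
  | .nil, m => m
  | .node _ l r, m => leafWeight l m * leafWeight r (m + l.numNodes)

theorem leafWeight_pos (t : FullTree) {m : ℕ} (hm : 0 < m) : 0 < leafWeight t m := by
  induction t generalizing m with
  | nil => exact hm
  | node _ _ _ hl hr => exact Nat.mul_pos (hl hm) (hr (Nat.add_pos_left hm _))

theorem prod_leaves_add_ncard_internalBefore (t : FullTree) (m : ℕ) :
    ∏ a ∈ leaves t, (m + (internalBefore t a).ncard) = leafWeight t m := by
  induction t generalizing m with
  | nil => simp [leaves, internalBefore, leafWeight]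
  | node x l r hl hr =>
    rw [prod_leaves_node, leafWeight, ← hl, ← hr]
    congr 1
    · exact prod_congr rfl fun a ha => by rw [ncard_internalBefore_node_false (mem_leaves.1 ha)]
    · exact prod_congr rfl fun a ha => by
        rw [ncard_internalBefore_node_true (mem_leaves.1 ha), add_assoc]

/-- The choices of a target for every pointer of a relaxed tree with spine `t`. -/
abbrev PointerAssignment (t : FullTree) : Type :=
  (a : {a : Address // IsPointerPosition t a}) → {b : Address // IsNode t b ∧ VisitedBefore t b a}

theorem card_pointerAssignment (t : FullTree) :
    Nat.card (PointerAssignment t) = leafWeight t 1 := by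
  have : Fintype {a : Address // IsPointerPosition t a} :=
    .subtype ((leaves t).erase (firstLeaf t)) fun a => by
      simp [IsPointerPosition, isFirstLeaf_iff, and_comm]
  calc Nat.card (PointerAssignment t)
      = ∏ a : {a // IsPointerPosition t a}, (1 + (internalBefore t a).ncard) := by
        rw [Nat.card_pi]
        exact prod_congr rfl fun a _ => ncard_targets a.2
    _ = ∏ a ∈ (leaves t).erase (firstLeaf t), (1 + (internalBefore t a).ncard) := by
        refine (prod_subtype _ (fun a => ?_) fun a => 1 + (internalBefore t a).ncard).symm
        simp [IsPointerPosition, isFirstLeaf_iff, and_comm]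
    _ = ∏ a ∈ leaves t, (1 + (internalBefore t a).ncard) :=
        prod_erase _ (by rw [internalBefore_firstLeaf, Set.ncard_empty, add_zero])
    _ = leafWeight t 1 := prod_leaves_add_ncard_internalBefore t 1

instance (t : FullTree) : Finite (PointerAssignment t) :=
  Nat.finite_of_card_ne_zero (by
    rw [card_pointerAssignment]
    exact (leafWeight_pos t one_pos).ne')

/-- Every internal node has fewer than `j` right edges above it; only the empty tree satisfies
this for `j = 0`. -/
def RightBounded (j : ℕ) (t : FullTree) : Prop :=
  ∀ a, IsInternal t a → a.count true < j

@[simp] theorem rightBounded_nil (j : ℕ) : RightBounded j .nil :=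
  fun a h => absurd h (not_isInternal_nil a)

@[simp] theorem not_rightBounded_zero_node : ¬ RightBounded 0 (.node x l r) :=
  fun h => Nat.not_lt_zero _ (h [] isInternal_node_nil)

@[simp] theorem rightBounded_succ_node {j : ℕ} :
    RightBounded (j + 1) (.node x l r) ↔ RightBounded (j + 1) l ∧ RightBounded j r := by
  constructor
  · exact fun h => ⟨fun a ha => by simpa using h (false :: a) ha,
      fun a ha => by simpa using h (true :: a) ha⟩
  · rintro ⟨hl, hr⟩ (_ | ⟨_ | _, a⟩) ha
    · simp
    · simpa using hl a ha
    · simpa using hr a ha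

theorem rightHeight_le_iff {k : ℕ} : rightHeight t ≤ k ↔ RightBounded (k + 1) t := by
  have hbdd : BddAbove {m : ℕ | ∃ a : Address, IsInternal t a ∧ a.count true = m} :=
    ((finite_setOf_isInternal t).image (List.count true)).bddAbove
  rw [rightHeight, RightBounded]
  constructor
  · exact fun h a ha => Nat.lt_succ_of_le ((le_csSup hbdd ⟨a, ha, rfl⟩).trans h)
  · refine fun h => csSup_le' ?_
    rintro _ ⟨a, ha, rfl⟩
    exact Nat.le_of_lt_succ (h a ha)

/-! ### Weighted trees and forests of bounded right height -/

open Classical in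
/-- The number of trees of size `n` satisfying `RightBounded j`, weighted by `leafWeight`. -/
noncomputable def treeSum (j n m : ℕ) : ℕ :=
  ∑ t ∈ treesOfNumNodesEq n with RightBounded j t, leafWeight t m

open Classical in
/-- A relaxed tree of bounded right height as its spine together with its pointers. -/
noncomputable def relaxedTreeEquiv (k n : ℕ) :
    {T : RelaxedTree n // rightHeight T.tree ≤ k} ≃
      Σ t : {t // t ∈ (treesOfNumNodesEq n).filter (RightBounded (k + 1))},
        PointerAssignment t.1 where
  toFun T := ⟨⟨T.1.tree, mem_filter.2
    ⟨mem_treesOfNumNodesEq.2 T.1.size_eq, rightHeight_le_iff.1 T.2⟩⟩, T.1.pointer⟩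
  invFun S := ⟨⟨S.1.1, mem_treesOfNumNodesEq.1 (mem_filter.1 S.1.2).1, S.2⟩,
    rightHeight_le_iff.2 (mem_filter.1 S.1.2).2⟩
  left_inv _ := rfl
  right_inv _ := rfl

theorem relaxedCount_eq_treeSum (k n : ℕ) : relaxedCount k n = treeSum (k + 1) n 1 := by
  rw [relaxedCount, Nat.card_congr (relaxedTreeEquiv k n), Nat.card_sigma]
  simp only [card_pointerAssignment]
  exact sum_coe_sort _ fun t => leafWeight t 1

theorem treeSum_zero_right (j m : ℕ) : treeSum j 0 m = m := by
  simp [treeSum, sum_filter, leafWeight]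

theorem sum_treesOfNumNodesEq_succ {M : Type*} [AddCommMonoid M] (n : ℕ) (f : FullTree → M) :
    ∑ t ∈ treesOfNumNodesEq (n + 1), f t = ∑ p ∈ antidiagonal n,
      ∑ l ∈ treesOfNumNodesEq p.1, ∑ r ∈ treesOfNumNodesEq p.2, f (.node () l r) := by
  rw [treesOfNumNodesEq_succ, sum_biUnion]
  · refine sum_congr rfl fun p _ => ?_
    rw [sum_map, sum_product]
    rfl
  · simp_rw [Set.PairwiseDisjoint, Set.Pairwise, disjoint_left]
    aesop

theorem treeSum_zero_succ (n m : ℕ) : treeSum 0 (n + 1) m = 0 := by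
  simp [treeSum, sum_filter, sum_treesOfNumNodesEq_succ]

theorem treeSum_succ_succ (j n m : ℕ) :
    treeSum (j + 1) (n + 1) m =
      ∑ p ∈ antidiagonal n, treeSum (j + 1) p.1 m * treeSum j p.2 (m + p.1) := by
  classical
  simp only [treeSum, sum_filter, sum_treesOfNumNodesEq_succ]
  refine sum_congr rfl fun p _ => ?_
  rw [sum_mul_sum]
  refine sum_congr rfl fun l hl => sum_congr rfl fun r _ => ?_
  rw [mem_treesOfNumNodesEq] at hl
  by_cases h1 : RightBounded (j + 1) l <;> by_cases h2 : RightBounded j r <;>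
    simp [leafWeight, h1, h2, hl]

/-- The number of forests of `s` trees with `q` internal nodes in total, where the `i`-th tree
(`i = 0, …, s - 1`) satisfies `RightBounded (K - i)`, weighted by the number of choices of a target
for every leaf. Such a forest is a stack in the post-order traversal of a tree satisfying
`RightBounded K`; the definition is only meaningful for `s ≤ K + 1`. -/
noncomputable def forestSum (K : ℕ) : ℕ → ℕ → ℕ
  | 0, q => if q = 0 then 1 else 0
  | s + 1, q => ∑ p ∈ antidiagonal q, forestSum K s p.1 * treeSum (K - s) p.2 (1 + p.1)

theorem forestSum_one (K q : ℕ) : forestSum K 1 q = treeSum K q 1 := by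
  rw [forestSum, sum_eq_single (0, q)]
  · simp [forestSum]
  · rintro ⟨i, j⟩ hij hne
    have hi : i ≠ 0 := by
      rintro rfl
      simp_all
    simp [forestSum, hi]
  · simp

theorem sum_antidiagonal_antidiagonal_snd {M : Type*} [AddCommMonoid M] (n : ℕ)
    (f : ℕ → ℕ → ℕ → M) :
    ∑ p ∈ antidiagonal n, ∑ r ∈ antidiagonal p.2, f p.1 r.1 r.2 =
      ∑ p ∈ antidiagonal n, ∑ r ∈ antidiagonal p.1, f r.1 r.2 p.2 := by
  rw [sum_sigma', sum_sigma']
  refine sum_nbij' (fun x => ⟨(x.1.1 + x.2.1, x.2.2), (x.1.1, x.2.1)⟩)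
    (fun x => ⟨(x.2.1, x.2.2 + x.1.2), (x.2.2, x.1.2)⟩) ?_ ?_ ?_ ?_ ?_
  all_goals
    rintro ⟨⟨a, b⟩, ⟨c, d⟩⟩ h
    simp only [mem_sigma, HasAntidiagonal.mem_antidiagonal] at h ⊢
  · exact ⟨by omega, trivial⟩
  · exact ⟨by omega, trivial⟩
  · simp [h.2]
  · simp [h.2]

theorem forestSum_succ_zero (K s : ℕ) : forestSum K (s + 1) 0 = forestSum K s 0 := by
  simp [forestSum, treeSum_zero_right]

theorem forestSum_top (K q : ℕ) : forestSum K (K + 1) q = (1 + q) * forestSum K K q := by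
  cases q with
  | zero => simp [forestSum_succ_zero]
  | succ q =>
    rw [forestSum, Nat.sum_antidiagonal_succ']
    simp [treeSum_zero_right, treeSum_zero_succ, mul_comm]

/-- The last tree is either a leaf, with `2 + q` possible targets, or has a root, whose removal
leaves two trees in its place. -/
theorem forestSum_succ_succ {K s : ℕ} (hs : s < K) (q : ℕ) :
    forestSum K (s + 1) (q + 1) =
      (2 + q) * forestSum K s (q + 1) + forestSum K (s + 2) q := by
  obtain ⟨j, rfl⟩ : ∃ j, K = s + j + 1 := ⟨K - s - 1, by omega⟩
  have hlast : s + j + 1 - s = j + 1 := by omega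
  have hnew : s + j + 1 - (s + 1) = j := by omega
  rw [forestSum, Nat.sum_antidiagonal_succ', forestSum]
  simp only [treeSum_zero_right, hlast, hnew, treeSum_succ_succ]
  congr 1
  · ring
  · simp only [forestSum, hlast, mul_sum, sum_mul]
    rw [sum_antidiagonal_antidiagonal_snd q fun a b c => forestSum (s + j + 1) s a *
      (treeSum (j + 1) b (1 + a) * treeSum j c (1 + a + b))]
    refine sum_congr rfl fun p _ => sum_congr rfl fun r hr => ?_
    rw [HasAntidiagonal.mem_antidiagonal] at hr
    rw [← hr, mul_assoc, add_assoc 1]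

/-- The weighted number of initial segments of post-order traversals of trees of right height at
most `k` that visit `p` leaves after the first one and leave `h + 1` trees on the stack. A binary
forest of `h + 1` trees with `p + 1` leaves has `p - h` internal nodes. -/
noncomputable def prefixCount (k p h : ℕ) : ℕ :=
  if h ≤ p ∧ h ≤ k + 1 then forestSum (k + 1) (h + 1) (p - h) else 0

theorem prefixCount_of_lt {k p h : ℕ} (hp : p < h) : prefixCount k p h = 0 :=
  if_neg fun hle => hp.not_ge hle.1

theorem relaxedCount_eq_prefixCount (k n : ℕ) : relaxedCount k n = prefixCount k n 0 := by
  rw [relaxedCount_eq_treeSum, prefixCount, if_pos (by omega), forestSum_one, Nat.sub_zero]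

theorem prefixCount_succ_zero (k p : ℕ) : prefixCount k (p + 1) 0 = prefixCount k (p + 1) 1 := by
  rw [prefixCount, prefixCount, if_pos (by omega), if_pos (by omega), Nat.sub_zero,
    forestSum_succ_succ (by omega)]
  simp [forestSum]

theorem prefixCount_succ_succ {k h : ℕ} (hh : h ≤ k) (p : ℕ) :
    prefixCount k (p + 1) (h + 1) =
      (p + 1 - h) * prefixCount k p h + prefixCount k (p + 1) (h + 2) := by
  rcases lt_or_ge p h with hp | hp
  · simp [prefixCount_of_lt, hp, show p + 1 < h + 2 by omega]
  obtain ⟨q, rfl⟩ := Nat.exists_eq_add_of_le hp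
  rw [prefixCount, prefixCount, if_pos (by omega), if_pos (by omega),
    show h + q + 1 - (h + 1) = q by omega, show h + q + 1 - h = 1 + q by omega,
    show h + q - h = q by omega]
  rcases hh.lt_or_eq with hk | rfl
  · cases q with
    | zero => rw [prefixCount_of_lt (by omega), forestSum_succ_zero, add_zero, add_zero, one_mul]
    | succ q =>
      rw [prefixCount, if_pos (by omega), forestSum_succ_succ (by omega),
        show h + (q + 1) + 1 - (h + 2) = q by omega, show 1 + (q + 1) = 2 + q by omega]
  · rw [prefixCount, if_neg (by omega), forestSum_top, add_zero]

theorem prefixCount_succ {k h : ℕ} (hh : h ≤ k + 1) (p : ℕ) :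
    prefixCount k (p + 1) h = ∑ i ∈ Ico (h - 1) (k + 1), (p + 1 - i) * prefixCount k p i := by
  have key (h : ℕ) (hh : h ≤ k + 1) :
      prefixCount k (p + 1) (h + 1) = ∑ i ∈ Ico h (k + 1), (p + 1 - i) * prefixCount k p i := by
    induction hh using Nat.decreasingInduction with
    | self => simp [prefixCount]
    | of_succ h hlt ih =>
      rw [sum_eq_sum_Ico_succ_bot hlt, prefixCount_succ_succ (by omega), ih]
  cases h with
  | zero => exact (prefixCount_succ_zero k p).trans (key 0 (by omega))
  | succ h => exact key h (by omega)

theorem prefixCount_zero_pos (k p : ℕ) : 0 < prefixCount k p 0 := by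
  induction p with
  | zero => simp [prefixCount, forestSum_one, treeSum_zero_right]
  | succ p ih =>
    rw [prefixCount_succ (by omega)]
    exact sum_pos' (fun _ _ => Nat.zero_le _) ⟨0, by simp, Nat.mul_pos (by omega) ih⟩

/-! ### The transfer matrix and its eigenvectors -/

open Filter Asymptotics Matrix

/-- The vector of the numbers `prefixCount k p h` for `h = 0, …, k`, divided by `p!`. -/
noncomputable def scaledCount (k p : ℕ) : Fin (k + 1) → ℝ :=
  fun h => prefixCount k p h / p.factorial

/-- The matrix `T` of the steps of a post-order traversal: reading a leaf and then any number of
internal nodes turns a stack of `i + 1` trees into one of `h + 1` trees, where `h ≤ i + 1`. -/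
def transferMatrix (k : ℕ) : Matrix (Fin (k + 1)) (Fin (k + 1)) ℝ :=
  .of fun h i => if (h : ℕ) ≤ i + 1 then 1 else 0

/-- The diagonal matrix `D` with entries `0, …, k`. After `p + 1` leaves, a stack of `i + 1` trees
has `p - i` internal nodes, so that the next pointer has `p + 1 - i` possible targets; hence
`T * (1 - D / (p + 1))` governs the step from `scaledCount k p` to `scaledCount k (p + 1)`. -/
def indexMatrix (k : ℕ) : Matrix (Fin (k + 1)) (Fin (k + 1)) ℝ := diagonal fun i => (i : ℝ)

variable {k : ℕ}

theorem transferMatrix_mulVec (f : ℕ → ℝ) (h : Fin (k + 1)) :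
    (transferMatrix k *ᵥ fun i => f i) h = ∑ i ∈ Ico ((h : ℕ) - 1) (k + 1), f i := by
  have hIco : Ico ((h : ℕ) - 1) (k + 1) = {i ∈ range (k + 1) | (h : ℕ) ≤ i + 1} := by
    ext i
    simp only [mem_Ico, mem_filter, mem_range]
    omega
  rw [hIco, sum_filter, sum_range]
  simp [mulVec, dotProduct, transferMatrix]

theorem vecMul_transferMatrix {f : ℕ → ℝ} (hf : f (k + 1) = 0) (i : Fin (k + 1)) :
    ((fun h : Fin (k + 1) => f h) ᵥ* transferMatrix k) i = ∑ h ∈ range (i + 2), f h := by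
  have hrange : range ((i : ℕ) + 2) = {h ∈ range (k + 2) | h ≤ (i : ℕ) + 1} := by
    ext h
    simp only [mem_filter, mem_range]
    omega
  rw [hrange, sum_filter, sum_range_succ, hf, ite_self, add_zero, sum_range]
  simp [vecMul, dotProduct, transferMatrix]

theorem isPerturbedOrbit_scaledCount (k : ℕ) :
    IsPerturbedOrbit (transferMatrix k) (transferMatrix k * indexMatrix k) (scaledCount k) where
  pos p := by
    refine Pi.lt_def.2 ⟨fun h => by unfold scaledCount; positivity, 0, ?_⟩
    have := prefixCount_zero_pos k p
    simp only [scaledCount, Fin.val_zero, Pi.zero_apply]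
    positivity
  succ p := by
    have hterm (i : ℕ) : (((p + 1 - i) * prefixCount k p i : ℕ) : ℝ) / (p + 1).factorial =
        prefixCount k p i / p.factorial -
          1 / ((p : ℝ) + 1) * (i * (prefixCount k p i / p.factorial)) := by
      rcases lt_or_ge p i with hp | hp
      · simp [prefixCount_of_lt hp]
      · rw [Nat.factorial_succ]
        push_cast [Nat.cast_sub (hp.trans p.le_succ)]
        field_simp
    ext h
    rw [← mulVec_mulVec, ← mulVec_smul, ← mulVec_sub]
    have hvec : (scaledCount k p - (1 / ((p : ℝ) + 1)) • indexMatrix k *ᵥ scaledCount k p) =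
        fun i : Fin (k + 1) =>
          (((p + 1 - (i : ℕ)) * prefixCount k p i : ℕ) : ℝ) / (p + 1).factorial := by
      ext i
      rw [hterm]
      simp [scaledCount, indexMatrix, mulVec_diagonal]
    rw [hvec, transferMatrix_mulVec
      fun i => (((p + 1 - i) * prefixCount k p i : ℕ) : ℝ) / (p + 1).factorial, scaledCount,
      prefixCount_succ h.2.le, Nat.cast_sum, sum_div]

/-- The angle for which `4 * cos (angle k) ^ 2` is the largest eigenvalue of `transferMatrix k`. -/
noncomputable def angle (k : ℕ) : ℝ := Real.pi / (k + 3)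

theorem add_three_mul_angle (k : ℕ) : (k + 3) * angle k = Real.pi := by
  rw [angle]
  field_simp

theorem angle_pos (k : ℕ) : 0 < angle k := by
  rw [angle]
  positivity

theorem cos_angle_pos (k : ℕ) : 0 < Real.cos (angle k) := by
  have h := add_three_mul_angle k
  have hα := angle_pos k
  have hk : (0 : ℝ) ≤ k * angle k := by positivity
  exact Real.cos_pos_of_mem_Ioo ⟨by linarith, by linarith⟩

theorem sin_mul_angle_pos {z : ℝ} (hz : 0 < z) (hzk : z < k + 3) : 0 < Real.sin (z * angle k) := by
  have hα := angle_pos k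
  exact Real.sin_pos_of_pos_of_lt_pi (by positivity) (by rw [← add_three_mul_angle k]; gcongr)

theorem sin_sub_mul_angle (k : ℕ) (z : ℝ) :
    Real.sin ((k + 3 - z) * angle k) = Real.sin (z * angle k) := by
  rw [sub_mul, add_three_mul_angle, Real.sin_pi_sub]

theorem sin_add_two_mul (α z : ℝ) :
    Real.sin ((z + 2) * α) = 2 * Real.cos α * Real.sin ((z + 1) * α) - Real.sin (z * α) := by
  rw [show (z + 2) * α = (z + 1) * α + α by ring, show z * α = (z + 1) * α - α by ring,
    Real.sin_add, Real.sin_sub]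
  ring

/-- The entries of a left eigenvector of `transferMatrix k` for the eigenvalue `4 * cos α ^ 2`,
where `α = angle k`, continued to all indices. -/
noncomputable def leftEntry (α : ℝ) (h : ℕ) : ℝ := (2 * Real.cos α) ^ h * Real.sin ((h + 2) * α)

/-- The entries of a right eigenvector of `transferMatrix k` for the eigenvalue `4 * cos α ^ 2`,
where `α = angle k`, continued to all indices. -/
noncomputable def rightEntry (α : ℝ) (h : ℕ) : ℝ :=
  (2 * Real.cos α)⁻¹ ^ h * Real.sin ((h + 1) * α)

theorem sum_leftEntry (α : ℝ) (i : ℕ) :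
    ∑ h ∈ range (i + 2), leftEntry α h = 4 * Real.cos α ^ 2 * leftEntry α i := by
  induction i with
  | zero =>
    have h2 := sin_add_two_mul α 0
    have h3 := sin_add_two_mul α 1
    norm_num at h2 h3
    norm_num [sum_range_succ, leftEntry, h2, h3]
    ring
  | succ i ih =>
    have h := sin_add_two_mul α (i + 2)
    rw [show (i : ℝ) + 2 + 2 = i + 4 by ring, show (i : ℝ) + 2 + 1 = i + 3 by ring] at h
    rw [sum_range_succ, ih, leftEntry, leftEntry, leftEntry]
    push_cast
    rw [show (i : ℝ) + 2 + 2 = i + 4 by ring, show (i : ℝ) + 1 + 2 = i + 3 by ring, h]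
    ring

theorem leftEntry_angle_succ (k : ℕ) : leftEntry (angle k) (k + 1) = 0 := by
  rw [leftEntry]
  push_cast
  rw [add_assoc, show (1 : ℝ) + 2 = 3 by norm_num, add_three_mul_angle, Real.sin_pi, mul_zero]

theorem rightEntry_angle_add_two (k : ℕ) : rightEntry (angle k) (k + 2) = 0 := by
  rw [rightEntry]
  push_cast
  rw [add_assoc, show (2 : ℝ) + 1 = 3 by norm_num, add_three_mul_angle, Real.sin_pi, mul_zero]

theorem rightEntry_one {α : ℝ} (hα : Real.cos α ≠ 0) : rightEntry α 1 = rightEntry α 0 := by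
  have h := sin_add_two_mul α 0
  norm_num at h
  norm_num [rightEntry, h]
  field_simp

theorem rightEntry_add {α : ℝ} (hα : Real.cos α ≠ 0) (h : ℕ) :
    rightEntry α h + 4 * Real.cos α ^ 2 * rightEntry α (h + 2) =
      4 * Real.cos α ^ 2 * rightEntry α (h + 1) := by
  have e := sin_add_two_mul α (h + 1)
  rw [show (h : ℝ) + 1 + 2 = h + 2 + 1 by ring] at e
  simp only [rightEntry]
  push_cast
  rw [e, inv_pow, inv_pow, inv_pow]
  field_simp
  ring

theorem sum_rightEntry {h : ℕ} (hh : h ≤ k + 1) :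
    ∑ i ∈ Ico (h - 1) (k + 1), rightEntry (angle k) i =
      4 * Real.cos (angle k) ^ 2 * rightEntry (angle k) h := by
  have hcos := (cos_angle_pos k).ne'
  have key (h : ℕ) (hh : h ≤ k + 1) : ∑ i ∈ Ico h (k + 1), rightEntry (angle k) i =
      4 * Real.cos (angle k) ^ 2 * rightEntry (angle k) (h + 1) := by
    induction hh using Nat.decreasingInduction with
    | self => rw [Ico_self, sum_empty, rightEntry_angle_add_two, mul_zero]
    | of_succ h hlt ih => rw [sum_eq_sum_Ico_succ_bot hlt, ih, rightEntry_add hcos]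
  cases h with
  | zero =>
    rw [← rightEntry_one hcos]
    exact key 0 (by omega)
  | succ h => exact key h (by omega)

/-- The left Perron eigenvector of `transferMatrix k`. -/
noncomputable def leftVec (k : ℕ) : Fin (k + 1) → ℝ := fun h => leftEntry (angle k) h

/-- The right Perron eigenvector of `transferMatrix k`. -/
noncomputable def rightVec (k : ℕ) : Fin (k + 1) → ℝ := fun h => rightEntry (angle k) h

theorem leftVec_vecMul_transferMatrix (k : ℕ) :
    leftVec k ᵥ* transferMatrix k = (4 * Real.cos (angle k) ^ 2) • leftVec k :=
  funext fun i => (vecMul_transferMatrix (leftEntry_angle_succ k) i).trans (sum_leftEntry _ i)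

theorem transferMatrix_mulVec_rightVec (k : ℕ) :
    transferMatrix k *ᵥ rightVec k = (4 * Real.cos (angle k) ^ 2) • rightVec k :=
  funext fun h => (transferMatrix_mulVec _ h).trans (sum_rightEntry h.2.le)

theorem leftVec_pos (h : Fin (k + 1)) : 0 < leftVec k h := by
  have hh : (h : ℝ) ≤ k := by exact_mod_cast h.is_le
  have hcos := cos_angle_pos k
  have hsin := sin_mul_angle_pos (k := k) (z := h + 2) (by positivity) (by linarith)
  rw [leftVec, leftEntry]
  positivity

theorem rightVec_pos (h : Fin (k + 1)) : 0 < rightVec k h := by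
  have hh : (h : ℝ) ≤ k := by exact_mod_cast h.is_le
  have hcos := cos_angle_pos k
  have hsin := sin_mul_angle_pos (k := k) (z := h + 1) (by positivity) (by linarith)
  rw [rightVec, rightEntry]
  positivity

theorem leftVec_mul_rightVec (h : Fin (k + 1)) :
    leftVec k h * rightVec k h =
      Real.sin ((h + 2) * angle k) * Real.sin ((h + 1) * angle k) := by
  have hcos := (cos_angle_pos k).ne'
  rw [leftVec, rightVec, leftEntry, rightEntry, inv_pow]
  field_simp

theorem leftVec_mul_rightVec_rev (i : Fin (k + 1)) :
    leftVec k i.rev * rightVec k i.rev = leftVec k i * rightVec k i := by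
  have hrev : ((i.rev : ℕ) : ℝ) = k - i := by
    rw [Fin.val_rev, Nat.add_sub_add_right, Nat.cast_sub i.is_le]
  rw [leftVec_mul_rightVec, leftVec_mul_rightVec, hrev, mul_comm,
    ← sin_sub_mul_angle k (i + 2), ← sin_sub_mul_angle k (i + 1)]
  congr 3 <;> ring

theorem sum_val_mul_of_rev_symm {c : Fin (k + 1) → ℝ} (hc : ∀ i, c i.rev = c i) :
    ∑ i : Fin (k + 1), (i : ℝ) * c i = k / 2 * ∑ i, c i := by
  have hrev : ∑ i : Fin (k + 1), (i : ℝ) * c i = ∑ i : Fin (k + 1), ((k : ℝ) - i) * c i := by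
    rw [← Equiv.sum_comp Fin.revPerm]
    refine sum_congr rfl fun i _ => ?_
    rw [Fin.revPerm_apply, hc, Fin.val_rev, Nat.add_sub_add_right, Nat.cast_sub i.is_le]
  simp only [sub_mul, sum_sub_distrib, ← mul_sum] at hrev
  linarith

theorem leftVec_dotProduct_mulVec_rightVec (k : ℕ) :
    leftVec k ⬝ᵥ (transferMatrix k * indexMatrix k) *ᵥ rightVec k =
      4 * Real.cos (angle k) ^ 2 * (k / 2 * (leftVec k ⬝ᵥ rightVec k)) := by
  rw [← mulVec_mulVec, dotProduct_mulVec, leftVec_vecMul_transferMatrix, smul_dotProduct,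
    smul_eq_mul, dotProduct, dotProduct, ← sum_val_mul_of_rev_symm leftVec_mul_rightVec_rev]
  congr 1
  refine sum_congr rfl fun i _ => ?_
  rw [indexMatrix, mulVec_diagonal]
  ring

theorem exists_isEquivalent_scaledCount (k : ℕ) :
    ∃ c : ℝ, 0 < c ∧ (fun p => scaledCount k p 0) ~[atTop]
      fun p : ℕ => c * (4 * Real.cos (angle k) ^ 2) ^ p * (p : ℝ) ^ (-(k / 2 : ℝ)) := by
  have hcos := cos_angle_pos k
  have hlast (h : Fin (k + 1)) : 0 < transferMatrix k h (Fin.last k) := by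
    simp [transferMatrix, h.is_le.trans k.le_succ]
  have hnonneg (h i : Fin (k + 1)) : 0 ≤ transferMatrix k h i := by
    rw [transferMatrix, of_apply]
    positivity
  obtain ⟨c, hc, hequiv⟩ := (isPerturbedOrbit_scaledCount k).exists_isEquivalent hnonneg hlast
    (by positivity) leftVec_pos rightVec_pos (leftVec_vecMul_transferMatrix k)
    (transferMatrix_mulVec_rightVec k)
  have hdot : leftVec k ⬝ᵥ rightVec k ≠ 0 :=
    (sum_pos (fun i _ => mul_pos (leftVec_pos i) (rightVec_pos i)) univ_nonempty).ne'
  have hexponent : leftVec k ⬝ᵥ (transferMatrix k * indexMatrix k) *ᵥ rightVec k /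
      (4 * Real.cos (angle k) ^ 2 * (leftVec k ⬝ᵥ rightVec k)) = k / 2 := by
    rw [leftVec_dotProduct_mulVec_rightVec]
    field_simp
  refine ⟨c * rightVec k 0, mul_pos hc (rightVec_pos 0), ?_⟩
  simpa only [hexponent] using hequiv 0

theorem relaxedCount_eq_factorial_mul_scaledCount (k n : ℕ) :
    (relaxedCount k n : ℝ) = n.factorial * scaledCount k n 0 := by
  rw [relaxedCount_eq_prefixCount, scaledCount, Fin.val_zero]
  field_simp

end RelaxedTrees

theorem theorem3p1 (k : ℕ) :
    ∃ γ : ℝ, 0 < γ ∧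
      Asymptotics.IsEquivalent Filter.atTop
        (fun n : ℕ => (RelaxedTrees.relaxedCount k n : ℝ))
        (fun n : ℕ => γ * (n.factorial : ℝ) * (4 * Real.cos (Real.pi / ((k : ℝ) + 3)) ^ 2) ^ n *
          (n : ℝ) ^ (-(k : ℝ) / 2)) := by
  obtain ⟨γ, hγ, hequiv⟩ := RelaxedTrees.exists_isEquivalent_scaledCount k
  refine ⟨γ, hγ, ?_⟩
  simp only [RelaxedTrees.relaxedCount_eq_factorial_mul_scaledCount, neg_div]
  refine ((Asymptotics.IsEquivalent.refl (u := fun n : ℕ => (n.factorial : ℝ))).mul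
    hequiv).congr_right (.of_forall fun n => ?_)
  simp only [Pi.mul_apply, RelaxedTrees.angle]
  ring
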